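/- Let $r\ge 1$ and let $\overline n=(n_1,\dots,n_r)$ be a tuple of positive integers, with $|\overline n|:=n_1+\cdots+n_r$. Let $$P_{\overline n}=\bigl(S^{n_1}\times\cdots\times S^{n_r}\bigr)\big/\bigl((x_1,\dots,x_r)\sim(-x_1,\dots,-x_r)\bigr)$$ be the projective product space, a smooth manifold of dimension $|\overline n|$ whose smooth structure is induced from the product of the standard spheres through the quotient map. Then $P_{\overline n}$ is orientable if and only if $|\overline n|+r$ is even. -/

import Mathlib

open Metric
open scoped Manifold ContDiff

noncomputable section

/-! ### Orientability of smooth manifolds -/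

/-- A smooth finite-dimensional manifold `M` without boundary is *orientable* if it has an oriented
atlas: a family of smooth charts (members of the maximal smooth atlas) that covers `M` and whose
coordinate changes all have positive Jacobian determinant at every point where they are defined. -/
def IsOrientable {E : Type*} [NormedAddCommGroup E] [NormedSpace ℝ E] [FiniteDimensional ℝ E]
    {H : Type*} [TopologicalSpace H] (I : ModelWithCorners ℝ E H) [I.Boundaryless]
    (M : Type*) [TopologicalSpace M] [ChartedSpace H M] [IsManifold I ∞ M] : Prop :=
  ∃ A : Set (OpenPartialHomeomorph M H), A ⊆ IsManifold.maximalAtlas I ∞ M ∧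
    (∀ x : M, ∃ e ∈ A, x ∈ e.source) ∧
    ∀ e ∈ A, ∀ e' ∈ A, ∀ x ∈ e.source ∩ e'.source,
      0 < (fderiv ℝ (e'.extend I ∘ (e.extend I).symm) (e.extend I x)).det

/-! ### Products of spheres and the diagonal antipodal action -/

/-- The standard unit sphere `S^m` in `ℝ^(m+1)`. -/
abbrev StdSphere (m : ℕ) : Type := sphere (0 : EuclideanSpace ℝ (Fin (m + 1))) 1

/-- The group `{1, -1}` acts on `S^m` by `ε • x = ε x`. -/
instance StdSphere.instSMul (m : ℕ) : SMul ℤˣ (StdSphere m) where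
  smul ε x := ⟨(ε : ℤ) • (x : EuclideanSpace ℝ (Fin (m + 1))), by
    have hx : ‖(x : EuclideanSpace ℝ (Fin (m + 1)))‖ = 1 := norm_eq_of_mem_sphere x
    rcases Int.units_eq_one_or ε with rfl | rfl <;> simp [hx]⟩

theorem StdSphere.coe_smul {m : ℕ} (ε : ℤˣ) (x : StdSphere m) :
    ((ε • x : StdSphere m) : EuclideanSpace ℝ (Fin (m + 1))) =
      (ε : ℤ) • (x : EuclideanSpace ℝ (Fin (m + 1))) := rfl

instance StdSphere.instMulAction (m : ℕ) : MulAction ℤˣ (StdSphere m) where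
  one_smul x := Subtype.ext (by rw [StdSphere.coe_smul]; simp)
  mul_smul ε δ x := Subtype.ext (by
    rw [StdSphere.coe_smul, StdSphere.coe_smul, StdSphere.coe_smul, Units.val_mul, mul_smul])

theorem StdSphere.neg_one_smul {m : ℕ} (x : StdSphere m) : (-1 : ℤˣ) • x = -x :=
  Subtype.ext (by rw [StdSphere.coe_smul]; simp)

theorem StdSphere.contMDiff_smul {m : ℕ} (ε : ℤˣ) :
    ContMDiff (𝓡 m) (𝓡 m) ω (fun x : StdSphere m => ε • x) := by
  rcases Int.units_eq_one_or ε with rfl | rfl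
  · have h : (fun x : StdSphere m => (1 : ℤˣ) • x) = id := funext fun x => one_smul _ x
    rw [h]
    exact contMDiff_id
  · have := Fact.mk (@finrank_euclideanSpace_fin ℝ _ (m + 1))
    simpa only [StdSphere.neg_one_smul] using
      (contMDiff_neg_sphere : ContMDiff (𝓡 m) (𝓡 m) ω fun x : StdSphere m => -x)

instance StdSphere.instContinuousConstSMul (m : ℕ) : ContinuousConstSMul ℤˣ (StdSphere m) where
  continuous_const_smul ε := (StdSphere.contMDiff_smul ε).continuous

/-- The product `S^{n_1} × ⋯ × S^{n_r}`, with the product topology, the product charts and the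
diagonal action `ε • (x_1, …, x_r) = (ε x_1, …, ε x_r)` of `{1, -1}`. -/
abbrev SphereProduct {r : ℕ} (n : Fin r → ℕ) : Type := ∀ i, StdSphere (n i)

instance SphereProduct.instSMul {r : ℕ} (n : Fin r → ℕ) : SMul ℤˣ (SphereProduct n) :=
  Pi.instSMul

instance SphereProduct.instMulAction {r : ℕ} (n : Fin r → ℕ) : MulAction ℤˣ (SphereProduct n) :=
  Pi.mulAction ℤˣ

instance SphereProduct.instContinuousConstSMul {r : ℕ} (n : Fin r → ℕ) :
    ContinuousConstSMul ℤˣ (SphereProduct n) where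
  continuous_const_smul ε := continuous_pi fun i =>
    (continuous_const_smul ε).comp (continuous_apply (A := fun i => StdSphere (n i)) i)

/-- The diagonal antipodal action is free when there is at least one factor. -/
instance SphereProduct.instIsCancelSMul {r : ℕ} [NeZero r] (n : Fin r → ℕ) :
    IsCancelSMul ℤˣ (SphereProduct n) where
  left_cancel' ε x y h := smul_left_cancel ε h
  right_cancel' ε δ x h := by
    have h0 : ε • x 0 = δ • x 0 := congrFun h 0
    have hx : x 0 ≠ -x 0 := ne_neg_of_mem_unit_sphere ℝ (x 0)
    rcases Int.units_eq_one_or ε with rfl | rfl <;> rcases Int.units_eq_one_or δ with rfl | rfl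
    · rfl
    · rw [one_smul, StdSphere.neg_one_smul] at h0
      exact absurd h0 hx
    · rw [one_smul, StdSphere.neg_one_smul] at h0
      exact absurd h0.symm hx
    · rfl

/-! ### Projective product spaces -/

/-- The projective product space `P_n = (S^{n_1} × ⋯ × S^{n_r}) / (x ∼ -x)`, as the orbit space of
the diagonal antipodal action, with the quotient topology. -/
abbrev ProjectiveProductSpace {r : ℕ} (n : Fin r → ℕ) : Type :=
  MulAction.orbitRel.Quotient ℤˣ (SphereProduct n)

/-- Two points of the product of spheres have the same image iff they are equal or antipodal. -/
theorem ProjectiveProductSpace.mk_eq_mk_iff {r : ℕ} (n : Fin r → ℕ) (x y : SphereProduct n) :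
    (Quotient.mk _ x : ProjectiveProductSpace n) = Quotient.mk _ y ↔ x = y ∨ x = -y := by
  have h0 : (Quotient.mk _ x : ProjectiveProductSpace n) = Quotient.mk _ y ↔
      ∃ ε : ℤˣ, ε • y = x := Quotient.eq
  rw [h0]
  have h1 : (-1 : ℤˣ) • y = -y := funext fun i => StdSphere.neg_one_smul (y i)
  constructor
  · rintro ⟨ε, rfl⟩
    rcases Int.units_eq_one_or ε with rfl | rfl
    · exact Or.inl (one_smul _ _)
    · exact Or.inr h1
  · rintro (rfl | rfl)
    · exact ⟨1, one_smul _ _⟩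
    · exact ⟨-1, h1⟩

/-- The model of `P_n`: the vector space `ℝ^{n_1} × ⋯ × ℝ^{n_r}`, of dimension
`n_1 + ⋯ + n_r`. -/
abbrev projModel {r : ℕ} (n : Fin r → ℕ) :
    ModelWithCorners ℝ (∀ i, EuclideanSpace ℝ (Fin (n i)))
      (ModelPi fun i => EuclideanSpace ℝ (Fin (n i))) :=
  ModelWithCorners.pi fun i => 𝓡 (n i)

instance projModel.instBoundaryless {r : ℕ} (n : Fin r → ℕ) : (projModel n).Boundaryless where
  range_eq_univ := Set.range_eq_univ.mpr fun y => ⟨y, rfl⟩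

/-- `P_n` carries the charts that are inverted locally by
`ℝ^{n_1} × ⋯ × ℝ^{n_r} ⇀ S^{n_1} × ⋯ × S^{n_r} → P_n`, a product of stereographic
parametrizations followed by the quotient map. -/
instance ProjectiveProductSpace.instChartedSpace {r : ℕ} [NeZero r] (n : Fin r → ℕ) :
    ChartedSpace (ModelPi fun i => EuclideanSpace ℝ (Fin (n i))) (ProjectiveProductSpace n) :=
  MulAction.instChartedSpaceQuotient

theorem ProjectiveProductSpace.isLocalHomeomorph_mk {r : ℕ} [NeZero r] (n : Fin r → ℕ) :
    IsLocalHomeomorph (Quotient.mk _ : SphereProduct n → ProjectiveProductSpace n) :=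
  isQuotientCoveringMap_quotientMk_of_properlyDiscontinuousSMul.isCoveringMap.isLocalHomeomorph

/-- Near a point, a local inverse of the quotient map is a lift by an element of `{1, -1}`. -/
theorem ProjectiveProductSpace.localInverseAt_mk_eventuallyEq {r : ℕ} [NeZero r] (n : Fin r → ℕ)
    (hf : IsLocalHomeomorph (Quotient.mk _ : SphereProduct n → ProjectiveProductSpace n))
    (q x : SphereProduct n)
    (hx : (Quotient.mk _ x : ProjectiveProductSpace n) ∈ (hf.localInverseAt q).source) :
    ∃ ε : ℤˣ, ∀ᶠ y in nhds x,
      hf.localInverseAt q (Quotient.mk _ y : ProjectiveProductSpace n) = ε • y := by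
  have h1 := hf.apply_localInverseAt_of_mem hx
  obtain ⟨ε, hε⟩ : ∃ ε : ℤˣ, ε • x = hf.localInverseAt q (Quotient.mk _ x) :=
    MulAction.orbitRel_apply.mp (Quotient.exact h1)
  refine ⟨ε, ?_⟩
  have hmem : ε • x ∈ (hf.localInverseAt q).target := hε ▸ (hf.localInverseAt q).map_source hx
  have hcont : Continuous fun y : SphereProduct n => ε • y := continuous_const_smul ε
  filter_upwards [hcont.continuousAt.preimage_mem_nhds
    ((hf.localInverseAt q).open_target.mem_nhds hmem)] with y hy
  have h2 : (Quotient.mk _ y : ProjectiveProductSpace n) = Quotient.mk _ (ε • y) :=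
    Quotient.sound ⟨ε⁻¹, inv_smul_smul ε y⟩
  rw [h2]
  have h3 := (hf.localInverseAt q).right_inv hy
  rwa [hf.localInverseAt_symm] at h3

/-- In stereographic charts the action of `{1, -1}` on a sphere is analytic. -/
theorem StdSphere.contDiffAt_chart_smul {m : ℕ} (ε : ℤˣ) (q q' : StdSphere m)
    (z : EuclideanSpace ℝ (Fin m))
    (hz : z ∈ (chartAt (EuclideanSpace ℝ (Fin m)) q).target)
    (hz' : ε • (chartAt (EuclideanSpace ℝ (Fin m)) q).symm z ∈
      (chartAt (EuclideanSpace ℝ (Fin m)) q').source) :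
    ContDiffAt ℝ ω (fun w => chartAt (EuclideanSpace ℝ (Fin m)) q'
      (ε • (chartAt (EuclideanSpace ℝ (Fin m)) q).symm w)) z := by
  rw [← contMDiffAt_iff_contDiffAt]
  have h1 : ContMDiffAt (𝓡 m) (𝓡 m) ω (chartAt (EuclideanSpace ℝ (Fin m)) q).symm z :=
    (contMDiffOn_chart_symm (I := 𝓡 m) (x := q)).contMDiffAt
      ((chartAt (EuclideanSpace ℝ (Fin m)) q).open_target.mem_nhds hz)
  have h2 : ContMDiffAt (𝓡 m) (𝓡 m) ω (chartAt (EuclideanSpace ℝ (Fin m)) q')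
      (ε • (chartAt (EuclideanSpace ℝ (Fin m)) q).symm z) :=
    (contMDiffOn_chart (I := 𝓡 m) (x := q')).contMDiffAt
      ((chartAt (EuclideanSpace ℝ (Fin m)) q').open_source.mem_nhds hz')
  exact h2.comp z (((StdSphere.contMDiff_smul ε) _).comp z h1)

/-- The coordinate changes between the charts of `P_n` are analytic. -/
theorem ProjectiveProductSpace.contDiffOn_transition {r : ℕ} [NeZero r] (n : Fin r → ℕ)
    (hf : IsLocalHomeomorph (Quotient.mk _ : SphereProduct n → ProjectiveProductSpace n))
    (q q' : SphereProduct n)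
    (e e' : OpenPartialHomeomorph (ProjectiveProductSpace n)
      (ModelPi fun i => EuclideanSpace ℝ (Fin (n i))))
    (he : e = (hf.localInverseAt q).trans (chartAt _ q))
    (he' : e' = (hf.localInverseAt q').trans (chartAt _ q')) :
    ContDiffOn ℝ ω (projModel n ∘ e.symm.trans e' ∘ (projModel n).symm)
      ((projModel n).symm ⁻¹' (e.symm.trans e').source ∩ Set.range (projModel n)) := by
  rintro z ⟨hz, -⟩
  apply ContDiffAt.contDiffWithinAt
  have hz1 : z ∈ (chartAt (ModelPi fun i => EuclideanSpace ℝ (Fin (n i))) q).target := by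
    subst he
    exact hz.1.1
  set c : (∀ i, EuclideanSpace ℝ (Fin (n i))) → SphereProduct n :=
    fun w i => (chartAt (EuclideanSpace ℝ (Fin (n i))) (q i)).symm (w i) with hc
  have hsymm : ∀ w, e.symm w = Quotient.mk _ (c w) := by
    subst he
    intro w
    exact congrFun (hf.localInverseAt_symm q) _
  have hz2 : e.symm z ∈ e'.source := hz.2
  rw [hsymm, he'] at hz2
  obtain ⟨ε, hε⟩ := ProjectiveProductSpace.localInverseAt_mk_eventuallyEq n hf q' (c z) hz2.1
  have hz3 : hf.localInverseAt q' (Quotient.mk _ (c z)) ∈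
      (chartAt (ModelPi fun i => EuclideanSpace ℝ (Fin (n i))) q').source := hz2.2
  rw [hε.self_of_nhds] at hz3
  have hccont : ContinuousAt c z :=
    (chartAt (ModelPi fun i => EuclideanSpace ℝ (Fin (n i))) q).symm.continuousAt hz1
  have hmain : ContDiffAt ℝ ω (fun (w : ∀ i, EuclideanSpace ℝ (Fin (n i))) i =>
      chartAt (EuclideanSpace ℝ (Fin (n i))) (q' i)
        (ε • (chartAt (EuclideanSpace ℝ (Fin (n i))) (q i)).symm (w i))) z := by
    rw [contDiffAt_pi]
    intro i
    have h1 := StdSphere.contDiffAt_chart_smul ε (q i) (q' i) (z i) (hz1 i trivial)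
      (hz3 i trivial)
    have h2 : ContDiffAt ℝ ω
        (fun w : ∀ j, EuclideanSpace ℝ (Fin (n j)) => w i) z :=
      (ContinuousLinearMap.proj (R := ℝ)
        (φ := fun j => EuclideanSpace ℝ (Fin (n j))) i).contDiff.contDiffAt
    exact ContDiffAt.comp (f := fun w : ∀ j, EuclideanSpace ℝ (Fin (n j)) => w i) z h1 h2
  refine hmain.congr_of_eventuallyEq ?_
  filter_upwards [hccont.eventually hε] with w hw
  change e' (e.symm w) = _
  rw [hsymm, he']
  change chartAt (ModelPi fun i => EuclideanSpace ℝ (Fin (n i))) q'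
    (hf.localInverseAt q' (Quotient.mk _ (c w))) = _
  rw [hw]
  rfl

/-- `P_n` with these charts is an analytic (in particular smooth) manifold. -/
instance ProjectiveProductSpace.instIsManifold {r : ℕ} [NeZero r] (n : Fin r → ℕ) :
    IsManifold (projModel n) ω (ProjectiveProductSpace n) := by
  apply isManifold_of_contDiffOn
  rintro _ _ ⟨p, rfl⟩ ⟨p', rfl⟩
  exact ProjectiveProductSpace.contDiffOn_transition n
    (ProjectiveProductSpace.isLocalHomeomorph_mk n) _ _ _ _ rfl rfl

end

open Metric
open scoped Manifold ContDiff

noncomputable section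

/-! ### Radial projection onto a product of spheres -/

/-! The product of spheres sits in V = ∏ ℝ^(n_i+1), of dimension |n| + r, with normal bundle
trivialized by the radii. A chart of P_n, applied to the class of (y_i/‖y_i‖), together with the
radii ‖y_i‖ gives local coordinates on V near each lift x of a point of its domain. The sign of
their Jacobian at x (`jacobian`) compares the chart with a fixed orientation of V. It is nonzero
(`jacobian_ne_zero`), and a change of chart multiplies it by the Jacobian of the coordinate change
(`jacobian_change`).

These coordinates are invariant under y ↦ -y, whose determinant on V is (-1)^(|n|+r). So the
Jacobians at x and -x differ by exactly this factor (`jacobian_neg`). For |n| + r odd, an oriented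
atlas would split the connected product of spheres into two open sets swapped by the antipode. For
|n| + r even, the sign descends to P_n, and the charts whose Jacobian is positive at every lift form
an oriented atlas. -/

/-- The radial projection `y ↦ y / ‖y‖` onto the unit sphere (with a junk value at `0`). -/
def StdSphere.radial {m : ℕ} (y : EuclideanSpace ℝ (Fin (m + 1))) : StdSphere m :=
  open Classical in
  if h : y = 0 then ⟨EuclideanSpace.single 0 1, by simp⟩
  else ⟨‖y‖⁻¹ • y, by simp [norm_smul, h]⟩

theorem StdSphere.coe_radial {m : ℕ} {y : EuclideanSpace ℝ (Fin (m + 1))} (hy : y ≠ 0) :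
    (StdSphere.radial y : EuclideanSpace ℝ (Fin (m + 1))) = ‖y‖⁻¹ • y := by
  simp [StdSphere.radial, hy]

theorem StdSphere.coe_ne_zero {m : ℕ} (x : StdSphere m) :
    (x : EuclideanSpace ℝ (Fin (m + 1))) ≠ 0 :=
  ne_zero_of_mem_unit_sphere x

theorem StdSphere.radial_coe {m : ℕ} (x : StdSphere m) :
    StdSphere.radial (x : EuclideanSpace ℝ (Fin (m + 1))) = x :=
  Subtype.ext (by rw [StdSphere.coe_radial x.coe_ne_zero, norm_eq_of_mem_sphere]; simp)

theorem StdSphere.radial_neg {m : ℕ} {y : EuclideanSpace ℝ (Fin (m + 1))} (hy : y ≠ 0) :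
    StdSphere.radial (-y) = -StdSphere.radial y :=
  Subtype.ext (by
    rw [StdSphere.coe_radial (neg_ne_zero.mpr hy), coe_neg_sphere, StdSphere.coe_radial hy]
    simp)

theorem StdSphere.contDiffAt_coe_radial {m : ℕ} {y : EuclideanSpace ℝ (Fin (m + 1))}
    (hy : y ≠ 0) :
    ContDiffAt ℝ ω (fun z => (StdSphere.radial z : EuclideanSpace ℝ (Fin (m + 1)))) y := by
  have h : ContDiffAt ℝ ω (fun z : EuclideanSpace ℝ (Fin (m + 1)) => ‖z‖⁻¹ • z) y :=
    ((contDiffAt_norm ℝ hy).inv (norm_ne_zero_iff.mpr hy)).smul contDiffAt_id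
  refine h.congr_of_eventuallyEq ?_
  filter_upwards [isOpen_ne.mem_nhds hy] with z hz
  exact StdSphere.coe_radial hz

theorem StdSphere.continuousAt_radial {m : ℕ} {y : EuclideanSpace ℝ (Fin (m + 1))}
    (hy : y ≠ 0) : ContinuousAt (StdSphere.radial (m := m)) y :=
  Topology.IsInducing.subtypeVal.continuousAt_iff.mpr
    (StdSphere.contDiffAt_coe_radial hy).continuousAt

/-- Charts of the sphere are analytic along maps that are analytic into the ambient space. -/
theorem StdSphere.contDiffAt_chart_comp {m : ℕ} (q : StdSphere m) {F : Type*}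
    [NormedAddCommGroup F] [NormedSpace ℝ F] {f : F → StdSphere m} {y : F}
    (hf : ContDiffAt ℝ ω (fun z => (f z : EuclideanSpace ℝ (Fin (m + 1)))) y)
    (hy : f y ∈ (chartAt (EuclideanSpace ℝ (Fin m)) q).source) :
    ContDiffAt ℝ ω (fun z => chartAt (EuclideanSpace ℝ (Fin m)) q (f z)) y := by
  have := Fact.mk (@finrank_euclideanSpace_fin ℝ _ (m + 1))
  have hs : (chartAt (EuclideanSpace ℝ (Fin m)) q).source = {-q}ᶜ :=
    stereographic'_source (-q)
  -- The chart at `q` projects from the pole `-q`; on the unit sphere, inner product 1 with the pole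
  -- characterizes the pole.
  have hne : innerSL ℝ ((-q : StdSphere m) : EuclideanSpace ℝ (Fin (m + 1))) (f y) ≠ (1 : ℝ) := by
    rw [hs] at hy
    intro h
    exact hy ((sphere_ext_iff _ _).mpr h).symm
  have hopen : IsOpen {x : EuclideanSpace ℝ (Fin (m + 1)) |
      innerSL ℝ ((-q : StdSphere m) : EuclideanSpace ℝ (Fin (m + 1))) x ≠ (1 : ℝ)} :=
    isOpen_ne_fun (innerSL ℝ _).continuous continuous_const
  have h1 := (contDiffOn_stereoToFun (n := ω)
    (v := ((-q : StdSphere m) : EuclideanSpace ℝ (Fin (m + 1))))).contDiffAt (hopen.mem_nhds hne)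
  have h2 := h1.comp y hf
  exact (OrthonormalBasis.fromOrthogonalSpanSingleton (𝕜 := ℝ) m
    (ne_zero_of_mem_unit_sphere (-q))).repr.contDiff.contDiffAt.comp y h2

/-- Inverse stereographic projection is defined on the whole model space; it supplies the angular
part of the inverse of polar coordinates. -/
theorem StdSphere.contDiff_coe_chart_symm {m : ℕ} (q : StdSphere m) :
    ContDiff ℝ ω (fun w => ((chartAt (EuclideanSpace ℝ (Fin m)) q).symm w :
      EuclideanSpace ℝ (Fin (m + 1)))) := by
  have := Fact.mk (@finrank_euclideanSpace_fin ℝ _ (m + 1))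
  have h1 := (OrthonormalBasis.fromOrthogonalSpanSingleton (𝕜 := ℝ) m
    (ne_zero_of_mem_unit_sphere (-q))).repr.symm.contDiff (n := ω)
  have h2 := (Submodule.subtypeL (ℝ ∙ ((-q : StdSphere m) :
    EuclideanSpace ℝ (Fin (m + 1))))ᗮ).contDiff (n := ω)
  have h3 := contDiff_stereoInvFunAux (m := ω)
    (v := ((-q : StdSphere m) : EuclideanSpace ℝ (Fin (m + 1))))
  exact h3.comp (h2.comp h1)

/-! ### The product of spheres in its ambient space -/

namespace SphereProduct

variable {r : ℕ} (n : Fin r → ℕ)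

/-- The product of Euclidean spaces that contains the product of spheres. -/
abbrev Ambient : Type := ∀ i, EuclideanSpace ℝ (Fin (n i + 1))

/-- The product of the Euclidean model spaces and of the space of radii. -/
abbrev PolarModel : Type := (∀ i, EuclideanSpace ℝ (Fin (n i))) × (Fin r → ℝ)

theorem finrank_ambient : Module.finrank ℝ (Ambient n) = (∑ i, n i) + r := by
  simp [Module.finrank_pi_fintype, Finset.sum_add_distrib]

/-- A linear identification of the polar model with the ambient space. -/
def polarModelEquiv : PolarModel n ≃L[ℝ] Ambient n :=
  ContinuousLinearEquiv.ofFinrankEq (by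
    rw [finrank_ambient]
    simp [Module.finrank_pi_fintype])

variable {n}

/-- The inclusion of the product of spheres in the ambient space. -/
def incl (x : SphereProduct n) : Ambient n := fun i => x i

theorem continuous_incl : Continuous (incl : SphereProduct n → Ambient n) :=
  continuous_pi fun i => continuous_subtype_val.comp
    (continuous_apply (A := fun i => StdSphere (n i)) i)

theorem incl_neg (x : SphereProduct n) : incl (-x) = -incl x := rfl

/-- The radial projection in each factor. -/
def radial (y : Ambient n) : SphereProduct n := fun i => StdSphere.radial (y i)

theorem radial_incl (x : SphereProduct n) : radial (incl x) = x :=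
  funext fun i => StdSphere.radial_coe (x i)

theorem eventually_ne_zero (x : SphereProduct n) : ∀ᶠ y in nhds (incl x), ∀ i, y i ≠ 0 := by
  rw [Filter.eventually_all]
  exact fun i => (continuous_apply i).continuousAt.eventually_ne (x i).coe_ne_zero

theorem continuousAt_radial (x : SphereProduct n) :
    ContinuousAt (radial : Ambient n → SphereProduct n) (incl x) :=
  continuousAt_pi.mpr fun i =>
    (StdSphere.continuousAt_radial (x i).coe_ne_zero).comp
      (f := fun y : Ambient n => y i) (continuous_apply i).continuousAt

theorem tendsto_radial (x : SphereProduct n) :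
    Filter.Tendsto (radial : Ambient n → SphereProduct n) (nhds (incl x)) (nhds x) := by
  simpa only [radial_incl] using (continuousAt_radial x).tendsto

/-- Positivity of the dimensions matters here: S^0 is disconnected. -/
theorem preconnectedSpace (hn : ∀ i, 0 < n i) : PreconnectedSpace (SphereProduct n) := by
  have (i : Fin r) : PreconnectedSpace (StdSphere (n i)) := by
    apply Subtype.preconnectedSpace
    apply isPreconnected_sphere
    rw [← Module.finrank_eq_rank, finrank_euclideanSpace_fin]
    exact_mod_cast Nat.succ_lt_succ (hn i)
  infer_instance

end SphereProduct

namespace ProjectiveProductSpace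

open SphereProduct

variable {r : ℕ} {n : Fin r → ℕ}

/-! ### The Jacobian of a chart in polar coordinates -/

/-- The quotient map of the projective product space. -/
abbrev mk (x : SphereProduct n) : ProjectiveProductSpace n := Quotient.mk _ x

theorem mk_neg (x : SphereProduct n) : mk (-x) = mk x :=
  (mk_eq_mk_iff n _ _).mpr (Or.inr rfl)

/-- The charts of the projective product space. -/
abbrev Chart (n : Fin r → ℕ) : Type :=
  OpenPartialHomeomorph (ProjectiveProductSpace n)
    (ModelPi fun i => EuclideanSpace ℝ (Fin (n i)))

/-- The polar coordinates of the ambient space that a chart of `P_n` induces: the coordinates of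
the class of `(y_i / ‖y_i‖)_i`, followed by the radii `‖y_i‖`. -/
def polar (e : Chart n) (y : Ambient n) : PolarModel n :=
  (e.extend (projModel n) (mk (radial y)), fun i => ‖y i‖)

/-- The Jacobian determinant of the polar coordinates at a point of the product of spheres. -/
def jacobian (e : Chart n) (x : SphereProduct n) : ℝ :=
  ((polarModelEquiv n : PolarModel n →L[ℝ] Ambient n) ∘L fderiv ℝ (polar e) (incl x)).det

theorem polar_neg_eventuallyEq (e : Chart n) (x : SphereProduct n) :
    (fun y => polar e (-y)) =ᶠ[nhds (incl x)] polar e := by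
  filter_upwards [eventually_ne_zero x] with y hy
  have h : radial (-y) = -radial y := funext fun i => StdSphere.radial_neg (hy i)
  simp only [polar, h, mk_neg, Pi.neg_apply, norm_neg]

/-- Since `polar e` is even near `incl x`, its derivatives at opposite points are negatives of each
other; the sign leaves the determinant to the power dim V. -/
theorem jacobian_neg (e : Chart n) (x : SphereProduct n) :
    jacobian e x = (-1) ^ ((∑ i, n i) + r) * jacobian e (-x) := by
  have h : fderiv ℝ (polar e) (incl x) = -fderiv ℝ (polar e) (incl (-x)) := by
    rw [← (polar_neg_eventuallyEq e x).fderiv_eq, incl_neg]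
    refine ((ContinuousLinearEquiv.neg ℝ : Ambient n ≃L[ℝ] Ambient n).comp_right_fderiv
      (f := polar e) (x := incl x)).trans ?_
    ext v : 1
    exact map_neg (fderiv ℝ (polar e) (-incl x)) v
  rw [jacobian, jacobian, h, ContinuousLinearMap.comp_neg, ContinuousLinearMap.det,
    ContinuousLinearMap.det, ContinuousLinearMap.toLinearMap_neg, ← neg_one_smul ℝ,
    LinearMap.det_smul, finrank_ambient]

theorem continuousAt_jacobian {e : Chart n} {x : SphereProduct n}
    (h : ContDiffAt ℝ ∞ (polar e) (incl x)) : ContinuousAt (jacobian e) x := by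
  have h1 : ContinuousAt (fderiv ℝ (polar e)) (incl x) :=
    (h.fderiv_right (m := 0) (by norm_num)).continuousAt
  have h2 : ContinuousAt (fun x => fderiv ℝ (polar e) (incl x)) x :=
    h1.comp continuous_incl.continuousAt
  exact ContinuousLinearMap.continuous_det.continuousAt.comp
    (((ContinuousLinearMap.compL ℝ (Ambient n) (PolarModel n) (Ambient n)
      (polarModelEquiv n : PolarModel n →L[ℝ] Ambient n)).continuous.continuousAt).comp h2)

/-- A differentiable left inverse of the polar coordinates makes the Jacobian nonzero. -/
theorem jacobian_ne_zero_of_leftInverse {e : Chart n} {x : SphereProduct n}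
    (h : DifferentiableAt ℝ (polar e) (incl x)) {G : PolarModel n → Ambient n}
    (hG : DifferentiableAt ℝ G (polar e (incl x)))
    (hGe : ∀ᶠ y in nhds (incl x), G (polar e y) = y) : jacobian e x ≠ 0 := by
  have h1 : fderiv ℝ G (polar e (incl x)) ∘L fderiv ℝ (polar e) (incl x) =
      ContinuousLinearMap.id ℝ (Ambient n) := by
    rw [← fderiv_comp _ hG h]
    exact (Filter.EventuallyEq.fderiv_eq (f := id) hGe).trans fderiv_id
  -- Inserting `polarModelEquiv` and its inverse makes both factors endomorphisms of `Ambient n`,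
  -- where the determinant is multiplicative.
  have h2 : (fderiv ℝ G (polar e (incl x)) ∘L
        ((polarModelEquiv n).symm : Ambient n →L[ℝ] PolarModel n)) ∘L
      ((polarModelEquiv n : PolarModel n →L[ℝ] Ambient n) ∘L fderiv ℝ (polar e) (incl x)) =
      ContinuousLinearMap.id ℝ (Ambient n) := by
    rw [← h1]
    ext v : 1
    simp
  intro h0
  have h3 := congrArg (fun T : Ambient n →L[ℝ] Ambient n => LinearMap.det (T : Ambient n →ₗ[ℝ] Ambient n)) h2
  simp only [ContinuousLinearMap.toLinearMap_comp _ (_ ∘L fderiv ℝ (polar e) (incl x)),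
    LinearMap.det_comp] at h3
  rw [jacobian, ContinuousLinearMap.det] at h0
  rw [h0] at h3
  simp at h3

/-! ### Behaviour under a change of chart -/

/-- A change of chart leaves the radii alone, so its derivative in polar coordinates is `T × id`;
conjugation by `L` preserves its determinant. -/
theorem linearMap_det_conj_prodMap {E F V : Type*} [AddCommGroup E] [Module ℝ E]
    [FiniteDimensional ℝ E] [AddCommGroup F] [Module ℝ F] [FiniteDimensional ℝ F]
    [AddCommGroup V] [Module ℝ V]
    (L : (E × F) ≃ₗ[ℝ] V) (T : E →ₗ[ℝ] E) (A : V →ₗ[ℝ] E × F) :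
    LinearMap.det (L.toLinearMap ∘ₗ (T.prodMap LinearMap.id ∘ₗ A)) =
      LinearMap.det T * LinearMap.det (L.toLinearMap ∘ₗ A) := by
  have h : L.toLinearMap ∘ₗ (T.prodMap LinearMap.id ∘ₗ A) =
      (L.toLinearMap ∘ₗ T.prodMap LinearMap.id ∘ₗ L.symm.toLinearMap) ∘ₗ
        (L.toLinearMap ∘ₗ A) := by
    ext v
    simp
  rw [h, LinearMap.det_comp, LinearMap.det_conj, LinearMap.det_prodMap, LinearMap.det_id, mul_one]

theorem continuous_mk : Continuous (mk : SphereProduct n → ProjectiveProductSpace n) :=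
  continuous_quotient_mk'

theorem eventually_mk_radial_mem_source {e : Chart n} {x : SphereProduct n}
    (hx : mk x ∈ e.source) : ∀ᶠ y in nhds (incl x), mk (radial y) ∈ e.source :=
  ((continuous_mk.tendsto x).comp (tendsto_radial x)).eventually (e.open_source.mem_nhds hx)

theorem polar_change_eventuallyEq {e : Chart n} (e' : Chart n) {x : SphereProduct n}
    (hx : mk x ∈ e.source) :
    polar e' =ᶠ[nhds (incl x)]
      Prod.map (e'.extend (projModel n) ∘ (e.extend (projModel n)).symm) id ∘ polar e := by
  filter_upwards [eventually_mk_radial_mem_source hx] with y hy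
  simp only [polar, Function.comp_apply, Prod.map_apply, id_eq]
  rw [e.extend_left_inv hy]

theorem polar_incl_fst (e : Chart n) (x : SphereProduct n) :
    (polar e (incl x)).1 = e.extend (projModel n) (mk x) := by
  rw [polar, radial_incl]

variable [NeZero r]

theorem contDiffAt_change {e e' : Chart n} (he : e ∈ IsManifold.maximalAtlas (projModel n) ∞ _)
    (he' : e' ∈ IsManifold.maximalAtlas (projModel n) ∞ _) {p : ProjectiveProductSpace n}
    (hp : p ∈ e.source) (hp' : p ∈ e'.source) :
    ContDiffAt ℝ ∞ (e'.extend (projModel n) ∘ (e.extend (projModel n)).symm)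
      (e.extend (projModel n) p) := by
  have h := (projModel n).contDiffWithinAt_extendCoordChange' he he' hp hp'
  rwa [ModelWithCorners.range_eq_univ, contDiffWithinAt_univ] at h

/-- Smoothness of polar coordinates thus needs checking for only one chart around each point. -/
theorem contDiffAt_polar_change {e e' : Chart n}
    (he : e ∈ IsManifold.maximalAtlas (projModel n) ∞ _)
    (he' : e' ∈ IsManifold.maximalAtlas (projModel n) ∞ _) {x : SphereProduct n}
    (hx : mk x ∈ e.source) (hx' : mk x ∈ e'.source)
    (h : ContDiffAt ℝ ∞ (polar e) (incl x)) : ContDiffAt ℝ ∞ (polar e') (incl x) := by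
  refine ContDiffAt.congr_of_eventuallyEq ?_ (polar_change_eventuallyEq e' hx)
  refine ContDiffAt.comp _ ?_ h
  refine ContDiffAt.prodMap' ?_ contDiffAt_id
  rw [polar_incl_fst]
  exact contDiffAt_change he he' hx hx'

/-- The Jacobian changes by the Jacobian of the coordinate change. -/
theorem jacobian_change {e e' : Chart n}
    (he : e ∈ IsManifold.maximalAtlas (projModel n) ∞ _)
    (he' : e' ∈ IsManifold.maximalAtlas (projModel n) ∞ _) {x : SphereProduct n}
    (hx : mk x ∈ e.source) (hx' : mk x ∈ e'.source)
    (h : ContDiffAt ℝ ∞ (polar e) (incl x)) :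
    jacobian e' x = (fderiv ℝ (e'.extend (projModel n) ∘ (e.extend (projModel n)).symm)
      (e.extend (projModel n) (mk x))).det * jacobian e x := by
  have hT := (contDiffAt_change he he' hx hx').differentiableAt (by simp)
  rw [← polar_incl_fst] at hT
  have hd : fderiv ℝ (polar e') (incl x) =
      ((fderiv ℝ (e'.extend (projModel n) ∘ (e.extend (projModel n)).symm)
        (e.extend (projModel n) (mk x))).prodMap (ContinuousLinearMap.id ℝ (Fin r → ℝ))) ∘L
        fderiv ℝ (polar e) (incl x) := by
    rw [(polar_change_eventuallyEq e' hx).fderiv_eq, ← polar_incl_fst]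
    exact ((hT.hasFDerivAt.prodMap _ (hasFDerivAt_id _)).comp _
      (h.differentiableAt (by simp)).hasFDerivAt).fderiv
  rw [jacobian, hd]
  exact linearMap_det_conj_prodMap (polarModelEquiv n).toLinearEquiv _ _

end ProjectiveProductSpace

/-! ### Regularity of the polar coordinates -/

theorem StdSphere.eventually_smul_radial_mem {m : ℕ} {ε : ℤˣ} {x : StdSphere m}
    {s : Set (StdSphere m)} (hs : IsOpen s) (hx : ε • x ∈ s) :
    ∀ᶠ z in nhds (x : EuclideanSpace ℝ (Fin (m + 1))), ε • StdSphere.radial z ∈ s := by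
  refine ((StdSphere.continuousAt_radial x.coe_ne_zero).const_smul ε).eventually
    (hs.mem_nhds ?_)
  rwa [Pi.smul_apply, StdSphere.radial_coe]

/-- A nonzero finite-dimensional real vector space has an orientation-reversing automorphism. -/
theorem exists_continuousLinearEquiv_det_neg (V : Type*) [NormedAddCommGroup V] [NormedSpace ℝ V]
    [FiniteDimensional ℝ V] [Nontrivial V] : ∃ T : V ≃L[ℝ] V, (T : V →L[ℝ] V).det < 0 := by
  let b := Module.finBasis ℝ V
  have : NeZero (Module.finrank ℝ V) := ⟨Module.finrank_pos.ne'⟩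
  -- The reflection that negates the first basis vector.
  let f : V →ₗ[ℝ] V := Matrix.toLin b b (Matrix.diagonal (Function.update 1 0 (-1)))
  have hf : LinearMap.det f = -1 := by
    rw [LinearMap.det_toLin, Matrix.det_diagonal, Finset.prod_update_of_mem (Finset.mem_univ _)]
    simp
  refine ⟨(LinearEquiv.ofIsUnitDet (f := f) (v := b) (v' := b) ?_).toContinuousLinearEquiv, ?_⟩
  · rw [LinearMap.det_toMatrix, hf]
    exact isUnit_one.neg
  · change LinearMap.det f < 0
    rw [hf]
    norm_num

namespace ProjectiveProductSpace

open SphereProduct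

variable {r : ℕ} {n : Fin r → ℕ}

/-- Stereographic projection and the norm are analytic away from their singularities, and the polar
coordinates have an explicit analytic left inverse. -/
theorem polar_regular_of_eventuallyEq {q x : SphereProduct n} {e : Chart n} {ε : ℤˣ}
    (hε : ∀ i, ε • x i ∈ (chartAt (EuclideanSpace ℝ (Fin (n i))) (q i)).source)
    (h : polar e =ᶠ[nhds (incl x)] fun y =>
        (fun i => chartAt (EuclideanSpace ℝ (Fin (n i))) (q i) (ε • StdSphere.radial (y i)),
          fun i => ‖y i‖)) :
    ContDiffAt ℝ ∞ (polar e) (incl x) ∧ jacobian e x ≠ 0 := by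
  have hproj (i : Fin r) : ContDiffAt ℝ ω (fun y : Ambient n => y i) (incl x) :=
    (ContinuousLinearMap.proj (R := ℝ)
      (φ := fun i => EuclideanSpace ℝ (Fin (n i + 1))) i).contDiff.contDiffAt
  have h1 : ContDiffAt ℝ ω (polar e) (incl x) := by
    refine ContDiffAt.congr_of_eventuallyEq ?_ h
    refine ContDiffAt.prodMk (contDiffAt_pi.mpr fun i => ?_) (contDiffAt_pi.mpr fun i => ?_)
    · refine StdSphere.contDiffAt_chart_comp (q i)
        (f := fun y : Ambient n => ε • StdSphere.radial (y i)) ?_ ?_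
      · have h2 : ContDiffAt ℝ ω (fun y : Ambient n =>
            (StdSphere.radial (y i) : EuclideanSpace ℝ (Fin (n i + 1)))) (incl x) :=
          (StdSphere.contDiffAt_coe_radial (x i).coe_ne_zero).comp
            (f := fun y : Ambient n => y i) (incl x) (hproj i)
        simp only [StdSphere.coe_smul]
        rcases Int.units_eq_one_or ε with rfl | rfl
        · simpa using h2
        · simpa using h2.neg
      · change ε • StdSphere.radial (x i : EuclideanSpace ℝ (Fin (n i + 1))) ∈ _
        rw [StdSphere.radial_coe]
        exact hε i
    · exact (contDiffAt_norm ℝ (x i).coe_ne_zero).comp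
        (f := fun y : Ambient n => y i) (incl x) (hproj i)
  have h2 : ContDiffAt ℝ ∞ (polar e) (incl x) := h1.of_le le_top
  refine ⟨h2, jacobian_ne_zero_of_leftInverse (h2.differentiableAt (by simp))
    -- Undo the stereographic projection, rescale by the radius, and undo the sign `ε`, which is its
    -- own inverse.
    (G := fun p i => ((ε : ℤ) : ℝ) • p.2 i • ((chartAt (EuclideanSpace ℝ (Fin (n i))) (q i)).symm
      (p.1 i) : EuclideanSpace ℝ (Fin (n i + 1)))) ?_ ?_⟩
  · refine ContDiffAt.differentiableAt (n := ω) (contDiffAt_pi.mpr fun i => ?_) (by simp)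
    have h3 : ContDiffAt ℝ ω (fun p : PolarModel n => p.1 i) (polar e (incl x)) :=
      contDiffAt_pi.mp contDiffAt_fst i
    have h4 : ContDiffAt ℝ ω (fun p : PolarModel n => p.2 i) (polar e (incl x)) :=
      contDiffAt_pi.mp contDiffAt_snd i
    have h5 := (StdSphere.contDiff_coe_chart_symm (q i)).contDiffAt.comp (polar e (incl x)) h3
    exact (h4.smul h5).const_smul ((ε : ℤ) : ℝ)
  · have hsrc : ∀ᶠ y in nhds (incl x), ∀ i, ε • StdSphere.radial (y i) ∈
        (chartAt (EuclideanSpace ℝ (Fin (n i))) (q i)).source := by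
      rw [Filter.eventually_all]
      intro i
      exact (hproj i).continuousAt.eventually (StdSphere.eventually_smul_radial_mem
        (OpenPartialHomeomorph.open_source _) (hε i))
    filter_upwards [h, hsrc, eventually_ne_zero x] with y hy hs hne
    rw [hy]
    funext i
    simp only
    rw [OpenPartialHomeomorph.left_inv _ (hs i), StdSphere.coe_smul,
      StdSphere.coe_radial (hne i)]
    have hn0 : ‖y i‖ ≠ 0 := norm_ne_zero_iff.mpr (hne i)
    rcases Int.units_eq_one_or ε with rfl | rfl <;> simp [smul_smul, hn0]

variable [NeZero r]

/-- Near a point, a chart from the atlas of `P_n` is a product of stereographic projections,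
applied to a representative of the class. -/
theorem exists_polar_eventuallyEq (q x : SphereProduct n)
    (hf : IsLocalHomeomorph (Quotient.mk _ : SphereProduct n → ProjectiveProductSpace n))
    (e : Chart n) (he : e = (hf.localInverseAt q).trans (chartAt _ q)) (hx : mk x ∈ e.source) :
    ∃ ε : ℤˣ, (∀ i, ε • x i ∈ (chartAt (EuclideanSpace ℝ (Fin (n i))) (q i)).source) ∧
      polar e =ᶠ[nhds (incl x)] fun y =>
        (fun i => chartAt (EuclideanSpace ℝ (Fin (n i))) (q i) (ε • StdSphere.radial (y i)),
          fun i => ‖y i‖) := by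
  subst he
  obtain ⟨ε, hε⟩ := localInverseAt_mk_eventuallyEq n hf q x hx.1
  have hx2 : hf.localInverseAt q (mk x) ∈
      (chartAt (ModelPi fun i => EuclideanSpace ℝ (Fin (n i))) q).source := hx.2
  rw [hε.self_of_nhds] at hx2
  refine ⟨ε, fun i => hx2 i trivial, ?_⟩
  filter_upwards [(tendsto_radial x).eventually hε] with y hy
  refine Prod.ext ?_ rfl
  change chartAt (ModelPi fun i => EuclideanSpace ℝ (Fin (n i))) q
    (hf.localInverseAt q (mk (radial y))) = _
  rw [hy]
  rfl

theorem exists_chart_regular (x : SphereProduct n) :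
    ∃ e ∈ IsManifold.maximalAtlas (projModel n) ∞ (ProjectiveProductSpace n), mk x ∈ e.source ∧
      ContDiffAt ℝ ∞ (polar e) (incl x) ∧ jacobian e x ≠ 0 := by
  refine ⟨chartAt _ (mk x), IsManifold.chart_mem_maximalAtlas _, mem_chart_source _ _, ?_⟩
  obtain ⟨ε, h1, h2⟩ := exists_polar_eventuallyEq _ x (isLocalHomeomorph_mk n)
    (chartAt _ (mk x)) rfl (mem_chart_source _ _)
  exact polar_regular_of_eventuallyEq h1 h2

theorem contDiffAt_polar {e : Chart n} (he : e ∈ IsManifold.maximalAtlas (projModel n) ∞ _)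
    {x : SphereProduct n} (hx : mk x ∈ e.source) : ContDiffAt ℝ ∞ (polar e) (incl x) := by
  obtain ⟨e₀, he₀, hx₀, h, -⟩ := exists_chart_regular x
  exact contDiffAt_polar_change he₀ he hx₀ hx h

/-- The Jacobian of `e` is a factor of the nonzero Jacobian of a regular chart at the same point. -/
theorem jacobian_ne_zero {e : Chart n} (he : e ∈ IsManifold.maximalAtlas (projModel n) ∞ _)
    {x : SphereProduct n} (hx : mk x ∈ e.source) : jacobian e x ≠ 0 := by
  obtain ⟨e₀, he₀, hx₀, -, h⟩ := exists_chart_regular x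
  rw [jacobian_change he he₀ hx hx₀ (contDiffAt_polar he hx)] at h
  exact right_ne_zero_of_mul h

/-! ### Non-orientability -/

/-- An oriented atlas makes the sign of the Jacobian of its charts a locally constant function on
the product of spheres. -/
theorem even_of_isOrientable (hn : ∀ i, 0 < n i)
    (h : IsOrientable (projModel n) (ProjectiveProductSpace n)) : Even ((∑ i, n i) + r) := by
  obtain ⟨A, hA, hcov, hpos⟩ := h
  by_contra hodd
  rw [Nat.not_even_iff_odd] at hodd
  have hsign {e e' : Chart n} (he : e ∈ A) (he' : e' ∈ A) {x : SphereProduct n}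
      (hx : mk x ∈ e.source) (hx' : mk x ∈ e'.source) (h0 : 0 < jacobian e x) :
      0 < jacobian e' x := by
    rw [jacobian_change (hA he) (hA he') hx hx' (contDiffAt_polar (hA he) hx)]
    exact mul_pos (hpos e he e' he' _ ⟨hx, hx'⟩) h0
  -- The points where the oriented atlas agrees with the orientation of V; by `hsign` the choice of
  -- chart in `A` is immaterial.
  set U : Set (SphereProduct n) := {x | ∃ e ∈ A, mk x ∈ e.source ∧ 0 < jacobian e x} with hU
  have hnear {e : Chart n} {x : SphereProduct n} (hx : mk x ∈ e.source) :
      ∀ᶠ y in nhds x, mk y ∈ e.source :=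
    (continuous_mk.tendsto x).eventually (e.open_source.mem_nhds hx)
  have hopen : IsOpen U := by
    rw [isOpen_iff_mem_nhds]
    rintro x ⟨e, he, hx, h0⟩
    filter_upwards [hnear hx, (continuousAt_jacobian (contDiffAt_polar (hA he) hx)).eventually
      (lt_mem_nhds h0)] with y hy hy0
    exact ⟨e, he, hy, hy0⟩
  have hclosed : IsClosed U := by
    rw [← isOpen_compl_iff, isOpen_iff_mem_nhds]
    intro x hxU
    obtain ⟨e, he, hx⟩ := hcov (mk x)
    have h0 : jacobian e x < 0 := lt_of_le_of_ne
      (not_lt.mp fun h0 => hxU ⟨e, he, hx, h0⟩) (jacobian_ne_zero (hA he) hx)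
    filter_upwards [hnear hx, (continuousAt_jacobian (contDiffAt_polar (hA he) hx)).eventually
      (gt_mem_nhds h0)] with y hy hy0
    rintro ⟨e', he', hy', hy0'⟩
    exact lt_asymm hy0 (hsign he' he hy' hy hy0')
  have := preconnectedSpace hn
  -- In odd total dimension the antipode exchanges `U` with its complement.
  have hneg (x : SphereProduct n) : x ∈ U ↔ -x ∉ U := by
    have hj (e : Chart n) : jacobian e x = -jacobian e (-x) := by
      rw [jacobian_neg e x, hodd.neg_one_pow, neg_one_mul]
    constructor
    · rintro ⟨e, he, hx, h0⟩ ⟨e', he', hx', h0'⟩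
      have h1 := hsign he' he hx' (by rwa [mk_neg]) h0'
      rw [hj] at h0
      linarith
    · intro hxU
      obtain ⟨e, he, hx⟩ := hcov (mk x)
      refine ⟨e, he, hx, ?_⟩
      have h1 : jacobian e (-x) ≤ 0 :=
        not_lt.mp fun h0 => hxU ⟨e, he, by rwa [mk_neg], h0⟩
      have h2 := jacobian_ne_zero (hA he) hx
      rw [hj] at h2 ⊢
      exact lt_of_le_of_ne (by linarith) h2.symm
  -- Any base point will do; this one is the junk value of `radial`.
  let x₀ : SphereProduct n := radial 0
  rcases isClopen_iff.mp ⟨hclosed, hopen⟩ with h0 | h0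
  · have h1 := hneg x₀
    simp [h0] at h1
  · have h1 := hneg x₀
    simp [h0] at h1

/-! ### Orientability -/

/-- Composition of a chart with a linear automorphism of the model. -/
theorem trans_continuousLinearEquiv_mem_maximalAtlas {e : Chart n}
    (he : e ∈ IsManifold.maximalAtlas (projModel n) ∞ _)
    (T : (∀ i, EuclideanSpace ℝ (Fin (n i))) ≃L[ℝ] (∀ i, EuclideanSpace ℝ (Fin (n i))))
    (g : OpenPartialHomeomorph (ModelPi fun i => EuclideanSpace ℝ (Fin (n i)))
      (ModelPi fun i => EuclideanSpace ℝ (Fin (n i))))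
    (hg : g = T.toHomeomorph.toOpenPartialHomeomorph) :
    e.trans g ∈ IsManifold.maximalAtlas (projModel n) ∞ _ := by
  have hgG : g ∈ contDiffGroupoid ∞ (projModel n) := by
    subst hg
    rw [contDiffGroupoid, mem_groupoid_of_pregroupoid]
    exact ⟨T.contDiff.contDiffOn, T.symm.contDiff.contDiffOn⟩
  intro e' he'
  obtain ⟨h1, h2⟩ := he e' he'
  constructor
  · rw [OpenPartialHomeomorph.trans_symm_eq_symm_trans_symm, OpenPartialHomeomorph.trans_assoc]
    exact (contDiffGroupoid ∞ (projModel n)).trans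
      ((contDiffGroupoid ∞ (projModel n)).symm hgG) h1
  · rw [← OpenPartialHomeomorph.trans_assoc]
    exact (contDiffGroupoid ∞ (projModel n)).trans h2 hgG

/-- Near every point there is a chart with positive Jacobian. -/
theorem exists_chart_jacobian_pos (hn : ∀ i, 0 < n i) (x : SphereProduct n) :
    ∃ e ∈ IsManifold.maximalAtlas (projModel n) ∞ (ProjectiveProductSpace n), mk x ∈ e.source ∧
      0 < jacobian e x := by
  obtain ⟨e, he, hx, -, h0⟩ := exists_chart_regular x
  rcases lt_or_gt_of_ne h0 with h0 | h0
  -- A negative Jacobian is repaired by an orientation-reversing linear map of the model, which must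
  -- be nonzero-dimensional.
  · have (i : Fin r) : NeZero (n i) := ⟨(hn i).ne'⟩
    have : Nontrivial (∀ i, EuclideanSpace ℝ (Fin (n i))) := Pi.nontrivial_at 0
    obtain ⟨T, hT⟩ := exists_continuousLinearEquiv_det_neg (∀ i, EuclideanSpace ℝ (Fin (n i)))
    have he' := trans_continuousLinearEquiv_mem_maximalAtlas he T _ rfl
    set e' : Chart n := e.trans T.toHomeomorph.toOpenPartialHomeomorph with he'_def
    have hx' : mk x ∈ e'.source := ⟨hx, trivial⟩
    refine ⟨e', he', hx', ?_⟩
    rw [jacobian_change he he' hx hx' (contDiffAt_polar he hx)]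
    refine mul_pos_of_neg_of_neg ?_ h0
    have h1 : (e'.extend (projModel n) ∘ (e.extend (projModel n)).symm)
        =ᶠ[nhds (e.extend (projModel n) (mk x))] T := by
      filter_upwards [e.open_target.mem_nhds (e.map_source hx)] with w hw
      exact congrArg T (e.right_inv hw)
    rw [h1.fderiv_eq, T.fderiv]
    exact hT
  · exact ⟨e, he, hx, h0⟩

theorem isOpenMap_mk : IsOpenMap (mk : SphereProduct n → ProjectiveProductSpace n) :=
  (isLocalHomeomorph_mk n).isOpenMap

theorem isOrientable_of_even (hn : ∀ i, 0 < n i) (heven : Even ((∑ i, n i) + r)) :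
    IsOrientable (projModel n) (ProjectiveProductSpace n) := by
  refine ⟨{e | e ∈ IsManifold.maximalAtlas (projModel n) ∞ (ProjectiveProductSpace n) ∧
    ∀ x, mk x ∈ e.source → 0 < jacobian e x}, fun e he => he.1, fun p => ?_, ?_⟩
  · obtain ⟨x, rfl⟩ := Quotient.exists_rep p
    obtain ⟨e, he, hx, h0⟩ := exists_chart_jacobian_pos hn x
    obtain ⟨U, hU, hUo, hxU⟩ := _root_.eventually_nhds_iff.mp
      ((continuousAt_jacobian (contDiffAt_polar he hx)).eventually (lt_mem_nhds h0))
    -- The lifts of `mk '' U` are `U` and `-U`; positivity on `U` passes to `-U` by parity.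
    have hs : IsOpen (mk '' U) := isOpenMap_mk U hUo
    have hsource : (e.restr (mk '' U)).source = e.source ∩ mk '' U :=
      e.restr_source' _ hs
    refine ⟨e.restr (mk '' U), ⟨restr_mem_maximalAtlas _ he hs, fun y hy => ?_⟩, ?_⟩
    · change 0 < jacobian e y
      rw [hsource] at hy
      obtain ⟨u, hu, huy⟩ := hy.2
      rcases (mk_eq_mk_iff n u y).mp huy with rfl | rfl
      · exact hU _ hu
      · rw [jacobian_neg, heven.neg_one_pow, one_mul]
        exact hU _ hu
    · rw [hsource]
      exact ⟨hx, x, hxU, rfl⟩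
  · rintro e ⟨he, hpos⟩ e' ⟨he', hpos'⟩ p ⟨hp, hp'⟩
    obtain ⟨x, rfl⟩ := Quotient.exists_rep p
    have h1 := hpos' x hp'
    rw [jacobian_change he he' hp hp' (contDiffAt_polar he hp)] at h1
    exact (pos_iff_pos_of_mul_pos h1).mpr (hpos x hp)

end ProjectiveProductSpace

end

theorem mainTheorem11 (r : ℕ) [NeZero r] (n : Fin r → ℕ) (hn : ∀ i, 0 < n i) :
    IsOrientable (projModel n) (ProjectiveProductSpace n) ↔ Even ((∑ i, n i) + r) :=
  ⟨ProjectiveProductSpace.even_of_isOrientable hn,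
    ProjectiveProductSpace.isOrientable_of_even hn⟩
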